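/- Let $d\ge 2$ be an integer and let $s\in(\max(d,4),+\infty)$; put $s':=\frac{s}{s-4}$, so that $2s'=\frac{2s}{s-4}\in(2,+\infty)$. For a compact set $K\subset\mathbb R^d$, constants $0<\alpha_m<\alpha_M<1$, $\alpha_*\in[\alpha_m,\alpha_M]$ and a measurable $\kappa:K\to[\alpha_m,\alpha_M]$, let $\alpha(x):=\kappa(x)$ for $x\in K$ and $\alpha(x):=\alpha_*$ for $x\in\mathbb R^d\setminus K$. Put $\theta:=\min\big(\frac{2\pi}{3},\frac{\pi}{2\alpha_*}\big)$. Powers $p^{a}$ are taken with the principal branch, $-\Delta+V$ is the operator in $L^2(\mathbb R^d)$ with domain $H^2(\mathbb R^d)$, and $\widehat{u_0}$ is the (unitary) Fourier transform of $u_0$; for $u_0\in L^1(\mathbb R^d)\cap L^2(\mathbb R^d)$ one has $\widehat{u_0}\in L^{2s'}(\mathbb R^d)$. a) There is a constant $C_0>0$ depending only on $d$ and $s$, and for every compact $K$ a constant $C>0$ depending only on $d$, $s$ and $K$, such that the following holds whenever $\alpha_*\left(1-\frac ds\right)<\alpha_m$. Put $$r_0:=\min\Big(1,\big(2C_0|K|^{2/s}\big)^{-1/(\alpha_m-\alpha_*(1-\frac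 ds))}\Big)>0$$ (with $r_0=1$ if $|K|=0$). Then, for all $p=re^{i\beta}$ with $r\in(0,r_0)$ and $\beta\in[-\theta,\theta]$, the operator $-\Delta+p^{\alpha_*}$ has a bounded inverse in $L^2(\mathbb R^d)$ with $$\big\|(p^{\alpha_*}-p^{\alpha})(-\Delta+p^{\alpha_*})^{-1}\big\|_{\mathcal B(L^2(\mathbb R^d))}\le\tfrac12,$$ and, if $\alpha$ is not a.e. equal to a constant, $-\Delta+p^{\alpha}$ has a bounded inverse in $L^2(\mathbb R^d)$ and, for all $u_0\in L^1(\mathbb R^d)\cap L^2(\mathbb R^d)$, $$\big\|(-\Delta+p^{\alpha})^{-1}p^{\alpha}u_0\big\|_{L^2(\mathbb R^d)}\le C\big(\|u_0\|_{L^2(\mathbb R^d)}+\|\widehat{u_0}\|_{L^{2s'}(\mathbb R^d)}\big)\,r^{\alpha_m-\alpha_*\left(1-\frac ds\right)}.$$ b) There is a constant $C>0$ depending only on $d$ and $s$ such that, if $\alpha=\alpha_*$ a.e. in $\mathbb R^d$ for some $\alpha_*\in(0,1)$, then for all $p=re^{i\beta}$ with $r\in(0,1)$ and $\beta\in[-\theta,\theta]$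 the operator $-\Delta+p^{\alpha}=-\Delta+p^{\alpha_*}$ has a bounded inverse in $L^2(\mathbb R^d)$ and, for all $u_0\in L^1(\mathbb R^d)\cap L^2(\mathbb R^d)$, $$\big\|(-\Delta+p^{\alpha_*})^{-1}p^{\alpha_*}u_0\big\|_{L^2(\mathbb R^d)}\le C\,\|\widehat{u_0}\|_{L^{2s'}(\mathbb R^d)}\,r^{\alpha_*\frac ds}.$$ -/

import Mathlib

open MeasureTheory Set
open scoped ENNReal SchwartzMap Laplacian FourierTransform

noncomputable section

/-- `ℝᵈ` with its Euclidean norm. -/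
abbrev Space (d : ℕ) : Type := EuclideanSpace ℝ (Fin d)

/-- The Hilbert space `L²(ℝᵈ; ℂ)`. -/
abbrev L2 (d : ℕ) : Type := Lp ℂ 2 (volume : Measure (Space d))

/-- `v` lies in the Sobolev space `H²(ℝᵈ)` and `-Δ v + V v = f`, where `Δ v` is the distributional
Laplacian (the function `w` below). -/
def SolvesNegLaplacianAdd {d : ℕ} (V : Space d → ℂ) (f v : L2 d) : Prop :=
  TemperedDistribution.MemSobolev 2 2 (v : 𝓢'(Space d, ℂ)) ∧
    ∃ w : L2 d, Δ (v : 𝓢'(Space d, ℂ)) = (w : 𝓢'(Space d, ℂ)) ∧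
      ∀ᵐ x : Space d, -(w x) + V x * v x = f x

/-- The bounded operator `R` on `L²(ℝᵈ)` is the inverse `(-Δ + V)⁻¹` of the operator `-Δ + V` with
domain `H²(ℝᵈ)`: for every `f` in `L²(ℝᵈ)`, `R f` is the unique `v` in `H²(ℝᵈ)` with
`-Δ v + V v = f`. -/
def IsInverseNegLaplacianAdd {d : ℕ} (V : Space d → ℂ) (R : L2 d →L[ℂ] L2 d) : Prop :=
  ∀ f v : L2 d, R f = v ↔ SolvesNegLaplacianAdd V f v

open scoped Classical in
/-- The variable order `α`, equal to `κ` on `K` and to the constant `αs` off `K`. -/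
def variableOrder {d : ℕ} (K : Set (Space d)) (αs : ℝ) (κ : Space d → ℝ) : Space d → ℝ :=
  fun x => if x ∈ K then κ x else αs

/-- The function `x ↦ p ^ α(x)` (principal branch of the power). -/
def powOrder {d : ℕ} (p : ℂ) (α : Space d → ℝ) : Space d → ℂ :=
  fun x => p ^ ((α x : ℝ) : ℂ)

/-- The angle `θ = min (2π/3, π/(2 αs))`. -/
def sectorAngle (αs : ℝ) : ℝ := min (2 * Real.pi / 3) (Real.pi / 2 * αs⁻¹)

/-- The radius `r₀ = min (1, (2 C₀ |K|^(2/s)) ^ (-1/(αm - αs (1 - d/s))))`; the power is computed in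
`[0, ∞]`, so that it is `∞`, and `r₀ = 1`, when `K` has measure zero. -/
def smallRadius {d : ℕ} (C₀ s : ℝ) (K : Set (Space d)) (αm αs : ℝ) : ℝ :=
  (min (1 : ℝ≥0∞)
    ((ENNReal.ofReal (2 * C₀) * (volume K) ^ (2 / s)) ^
      (-1 / (αm - αs * (1 - d / s))))).toReal

end

/-!
Put `z = p ^ αs` and `W = p ^ αs - p ^ α`, so that `-Δ + p ^ α = (-Δ + z) - W`. For `p` in the sector
`z` lies in the closed right half-plane (`re_polar_cpow_nonneg`), hence the symbol
`m(ξ) = (4π²|ξ|² + z)⁻¹` is bounded by `2 / (|z| + |ξ|²)`, the multiplier `R = 𝓕⁻¹ m 𝓕` is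
`(-Δ + z)⁻¹` (`isInverseNegLaplacianAdd_const`), and by scaling `‖m‖_{s/2} ≤ c |z| ^ (d/s - 1)` since
`s > d` (`exists_eLpNorm_resolventSymbol_le`).

The perturbation `W` vanishes off `K` and is at most `2 |p| ^ αm` on `K`. The main estimate is the
Kato–Seiler–Simon type bound `‖R W‖, ‖W R‖ ≤ 2 ‖W‖_∞ |K| ^ (2/s) ‖m‖_{s/2}`
(`norm_fourierMul_mulLp_le`, `norm_mulLp_fourierMul_le`). Because `W` is bounded with support of finite
measure, it needs no Hausdorff–Young inequality: the part of `m` above a height `l` is in `L²`, hence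
maps `L¹` to `L²` on the Fourier side, the part below has operator norm at most `l`, and one optimizes
in `l`. This gives `‖R W‖, ‖W R‖ ≤ C₀ |K| ^ (2/s) r ^ γ` with `γ = αm - αs (1 - d/s)` and `C₀ = 4 c`, and
the right-hand side is at most `1/2` because `r < r₀`.

Hence `(-Δ + p ^ α)⁻¹ = (1 - R W)⁻¹ R` with `‖(1 - R W)⁻¹‖ ≤ 2`
(`exists_isInverseNegLaplacianAdd_of_perturbation`). Applied to `p ^ α u₀ = z u₀ - W u₀`, this bounds the
solution by `2 (‖R z u₀‖ + ‖R W u₀‖)`. The second term is `O(r ^ γ) ‖u₀‖`, and Hölder's inequality on the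
Fourier side bounds the first one by `|z| ‖m‖_{s/2} ‖û₀‖_{2s'} = O(r ^ (αs d/s)) ‖û₀‖_{2s'}`
(`enorm_resolvent_le`), which is also the whole estimate for constant order.
-/

/-! ### Multiplication operators on `L²` -/

section Multiplication

variable {X : Type*} [MeasurableSpace X] {μ : Measure X}

/-- Multiplication by an essentially bounded function, as a bounded operator on `L²`. -/
noncomputable def mulLp {m : X → ℂ} (hm : MemLp m ∞ μ) : Lp ℂ 2 μ →L[ℂ] Lp ℂ 2 μ :=
  (ContinuousLinearMap.mul ℂ ℂ).holderL μ ∞ 2 2 hm.toLp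

theorem coeFn_mulLp {m : X → ℂ} (hm : MemLp m ∞ μ) (f : Lp ℂ 2 μ) :
    mulLp hm f =ᵐ[μ] fun x => m x * f x := by
  have h := (ContinuousLinearMap.mul ℂ ℂ).coeFn_holder (r := 2) hm.toLp f
  filter_upwards [h, hm.coeFn_toLp] with x hx hx'
  simp only [mulLp, ContinuousLinearMap.holderL_apply_apply]
  rw [hx, hx']
  rfl

theorem enorm_mulLp {m : X → ℂ} (hm : MemLp m ∞ μ) (f : Lp ℂ 2 μ) :
    ‖mulLp hm f‖ₑ = eLpNorm (fun x => m x * f x) 2 μ := by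
  rw [Lp.enorm_def]
  exact eLpNorm_congr_ae (coeFn_mulLp hm f)

theorem memLp_top_star {m : X → ℂ} (hm : MemLp m ∞ μ) :
    MemLp (fun x => starRingEnd ℂ (m x)) ∞ μ := hm.star

theorem inner_mulLp_left {m : X → ℂ} (hm : MemLp m ∞ μ) (f g : Lp ℂ 2 μ) :
    inner ℂ (mulLp hm f) g = inner ℂ f (mulLp (memLp_top_star hm) g) := by
  rw [L2.inner_def, L2.inner_def]
  apply integral_congr_ae
  filter_upwards [coeFn_mulLp hm f, coeFn_mulLp (memLp_top_star hm) g] with x h1 h2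
  rw [h1, h2]
  simp
  ring

/-- A bounded square-integrable function is in `L^q` for all finite `q ≥ 2`. -/
theorem memLp_of_memLp_two_of_bound {f : X → ℂ} (h2 : MemLp f 2 μ) {B : ℝ} (hB : ∀ x, ‖f x‖ ≤ B)
    {q : ℝ} (hq : 2 ≤ q) : MemLp f (ENNReal.ofReal q) μ := by
  have hq0 : ENNReal.ofReal q ≠ 0 := by simp; linarith
  refine ⟨h2.1, ?_⟩
  rw [eLpNorm_lt_top_iff_lintegral_rpow_enorm_lt_top hq0 ENNReal.ofReal_ne_top,
    ENNReal.toReal_ofReal (by linarith)]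
  have h2' := (eLpNorm_lt_top_iff_lintegral_rpow_enorm_lt_top (by norm_num) (by norm_num)).1 h2.2
  have hle : ∀ x, ‖f x‖ₑ ^ q ≤ ENNReal.ofReal B ^ (q - 2) * ‖f x‖ₑ ^ (2 : ℝ≥0∞).toReal := by
    intro x
    have hx : ‖f x‖ₑ ≤ ENNReal.ofReal B := by
      rw [← ofReal_norm]; exact ENNReal.ofReal_le_ofReal (hB x)
    calc ‖f x‖ₑ ^ q = ‖f x‖ₑ ^ (q - 2) * ‖f x‖ₑ ^ (2 : ℝ≥0∞).toReal := by
          rw [← ENNReal.rpow_add_of_nonneg _ _ (by linarith) (by simp)]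
          simp
      _ ≤ _ := by gcongr
  refine (lintegral_mono hle).trans_lt ?_
  rw [lintegral_const_mul' _ _ (by simp [ENNReal.rpow_eq_top_iff]; grind)]
  exact ENNReal.mul_lt_top (by simp [ENNReal.rpow_eq_top_iff, lt_top_iff_ne_top]; grind) h2'

end Multiplication

/-! ### The Fourier transform on `L¹ ∩ L²` and Fourier multipliers -/

section Fourier

variable {E : Type*} [NormedAddCommGroup E] [InnerProductSpace ℝ E] [FiniteDimensional ℝ E]
  [MeasurableSpace E] [BorelSpace E]

theorem norm_fourier_le_integral_norm (f : E → ℂ) (ξ : E) : ‖𝓕 f ξ‖ ≤ ∫ x, ‖f x‖ :=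
  VectorFourier.norm_fourierIntegral_le_integral_norm _ _ _ _ _

theorem continuous_fourier_of_integrable {f : E → ℂ} (hf : Integrable f) : Continuous (𝓕 f) :=
  VectorFourier.fourierIntegral_continuous Real.continuous_fourierChar
    (innerSL ℝ).continuous₂ hf

/-- On `L¹ ∩ L²` the Fourier integral represents the Fourier transform of `L²`. -/
theorem coeFn_fourier_toLp {f : E → ℂ} (h1 : MemLp f 1) (h2 : MemLp f 2) :
    (𝓕 (h2.toLp f) : Lp ℂ 2 (volume : Measure E)) =ᵐ[volume] 𝓕 f := by
  have hi : Integrable f := memLp_one_iff_integrable.1 h1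
  apply ae_eq_of_integral_contDiff_smul_eq
  · exact (Lp.memLp _).locallyIntegrable (by norm_num)
  · exact (continuous_fourier_of_integrable hi).locallyIntegrable
  intro g g_smooth g_cpt
  have hg₁ : HasCompactSupport (Complex.ofRealCLM ∘ g) := g_cpt.comp_left rfl
  have hg₂ : ContDiff ℝ (⊤ : ℕ∞) (Complex.ofRealCLM ∘ g) := by fun_prop
  set u : 𝓢(E, ℂ) := hg₁.toSchwartzMap hg₂ with hu
  have hux : ∀ x, u x = (g x : ℂ) := fun x => by simp [hu]
  have hL : ∫ x, g x • (𝓕 (h2.toLp f) : Lp ℂ 2 (volume : Measure E)) x =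
      ∫ x, (𝓕 u) x * f x := by
    have h := congrArg (fun T : 𝓢'(E, ℂ) => T u) (Lp.fourier_toTemperedDistribution_eq (h2.toLp f))
    simp only [TemperedDistribution.fourier_apply, Lp.toTemperedDistribution_apply] at h
    rw [show (∫ x, g x • (𝓕 (h2.toLp f) : Lp ℂ 2 (volume : Measure E)) x) =
      ∫ x, u x • (𝓕 (h2.toLp f) : Lp ℂ 2 (volume : Measure E)) x by simp [hux], ← h]
    apply integral_congr_ae
    filter_upwards [h2.coeFn_toLp] with x hx
    rw [hx, smul_eq_mul]
  have hR : ∫ x, g x • 𝓕 f x = ∫ x, (𝓕 u) x * f x := by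
    have h := VectorFourier.integral_bilin_fourierIntegral_eq_flip (ContinuousLinearMap.mul ℂ ℂ)
      (L := innerₗ E) (μ := volume) (ν := volume)
      Real.continuous_fourierChar continuous_inner u.integrable hi
    rw [SchwartzMap.fourier_coe]
    simp only [ContinuousLinearMap.mul_apply', flip_innerₗ] at h
    calc ∫ x, g x • 𝓕 f x = ∫ x, u x * 𝓕 f x := by simp [hux]
      _ = _ := h.symm
  rw [hL, hR]

theorem eLpNorm_fourier_top_le {f : E → ℂ} (h1 : MemLp f 1) :
    eLpNorm (𝓕 f) ∞ volume ≤ eLpNorm f 1 volume := by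
  have hi : Integrable f := memLp_one_iff_integrable.1 h1
  rw [eLpNorm_exponent_top]
  refine eLpNormEssSup_le_of_ae_enorm_bound (Filter.Eventually.of_forall fun ξ => ?_)
  rw [eLpNorm_one_eq_lintegral_enorm, ← ofReal_integral_norm_eq_lintegral_enorm hi, ← ofReal_norm]
  exact ENNReal.ofReal_le_ofReal (norm_fourier_le_integral_norm f ξ)

/-- The Fourier transform of a function in `L¹ ∩ L²` is in `L^q` for all finite `q ≥ 2`. -/
theorem memLp_fourier {f : E → ℂ} (h1 : MemLp f 1) (h2 : MemLp f 2) {q : ℝ} (hq : 2 ≤ q) :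
    MemLp (𝓕 f) (ENNReal.ofReal q) volume :=
  memLp_of_memLp_two_of_bound ((memLp_congr_ae (coeFn_fourier_toLp h1 h2)).1 (Lp.memLp _))
    (norm_fourier_le_integral_norm f) hq

/-- The Fourier multiplier `𝓕⁻¹ m 𝓕` on `L²` with an essentially bounded symbol `m`. -/
noncomputable def fourierMul {m : E → ℂ} (hm : MemLp m ∞ (volume : Measure E)) :
    Lp ℂ 2 (volume : Measure E) →L[ℂ] Lp ℂ 2 (volume : Measure E) :=
  ((Lp.fourierTransformₗᵢ E ℂ).symm : _ →L[ℂ] _) ∘L mulLp hm ∘L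
    ((Lp.fourierTransformₗᵢ E ℂ) : _ →L[ℂ] _)

theorem fourier_fourierMul {m : E → ℂ} (hm : MemLp m ∞ (volume : Measure E))
    (f : Lp ℂ 2 (volume : Measure E)) : 𝓕 (fourierMul hm f) = mulLp hm (𝓕 f) :=
  (Lp.fourierTransformₗᵢ E ℂ).apply_symm_apply _

theorem enorm_fourier_eq (f : Lp ℂ 2 (volume : Measure E)) : ‖𝓕 f‖ₑ = ‖f‖ₑ := by
  rw [← ofReal_norm, Lp.norm_fourier_eq, ofReal_norm]

theorem enorm_fourierMul {m : E → ℂ} (hm : MemLp m ∞ (volume : Measure E))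
    (f : Lp ℂ 2 (volume : Measure E)) :
    ‖fourierMul hm f‖ₑ = eLpNorm (fun ξ => m ξ * (𝓕 f : Lp ℂ 2 (volume : Measure E)) ξ) 2
      volume := by
  rw [← enorm_fourier_eq, fourier_fourierMul, enorm_mulLp]

theorem inner_fourierMul_left {m : E → ℂ} (hm : MemLp m ∞ (volume : Measure E))
    (f g : Lp ℂ 2 (volume : Measure E)) :
    inner ℂ (fourierMul hm f) g = inner ℂ f (fourierMul (memLp_top_star hm) g) := by
  rw [← Lp.inner_fourier_eq, ← Lp.inner_fourier_eq f, fourier_fourierMul, fourier_fourierMul,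
    inner_mulLp_left]

end Fourier

/-! ### Operator norms of products of a multiplication and a Fourier multiplier -/

/-- On the set where `‖m‖ > l`, the `L²` norm of `m` is controlled by its `L^σ` norm, `σ ≥ 2`. -/
theorem eLpNorm_two_indicator_lt_norm_le {X : Type*} [MeasurableSpace X] {μ : Measure X}
    {m : X → ℂ} {σ : ℝ} (hσ : 2 ≤ σ) {l B : ℝ} (hl : 0 < l) (hB : 0 < B)
    (hmB : eLpNorm m (ENNReal.ofReal σ) μ ≤ ENNReal.ofReal B) :
    eLpNorm ({x | l < ‖m x‖}.indicator m) 2 μ ≤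
      ENNReal.ofReal ((l ^ (2 - σ) * B ^ σ) ^ (1 / 2 : ℝ)) := by
  have hσ0 : ENNReal.ofReal σ ≠ 0 := by simp; linarith
  rw [eLpNorm_eq_lintegral_rpow_enorm_toReal hσ0 ENNReal.ofReal_ne_top,
    ENNReal.toReal_ofReal (by linarith)] at hmB
  have hint : ∫⁻ x, ‖m x‖ₑ ^ σ ∂μ ≤ ENNReal.ofReal (B ^ σ) := by
    have h := ENNReal.rpow_le_rpow hmB (z := σ) (by linarith)
    rwa [← ENNReal.rpow_mul, one_div, inv_mul_cancel₀ (by linarith), ENNReal.rpow_one,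
      ENNReal.ofReal_rpow_of_pos hB] at h
  rw [eLpNorm_eq_lintegral_rpow_enorm_toReal (by norm_num) (by norm_num), ENNReal.toReal_ofNat,
    ← ENNReal.ofReal_rpow_of_pos (by positivity)]
  gcongr
  calc ∫⁻ x, ‖{x | l < ‖m x‖}.indicator m x‖ₑ ^ (2 : ℝ) ∂μ
      ≤ ∫⁻ x, ENNReal.ofReal (l ^ (2 - σ)) * ‖m x‖ₑ ^ σ ∂μ := by
        refine lintegral_mono fun x => ?_
        by_cases hx : l < ‖m x‖
        · have hx0 : 0 < ‖m x‖ := hl.trans hx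
          rw [Set.indicator_of_mem (by exact hx), ← ofReal_norm,
            ENNReal.ofReal_rpow_of_pos hx0, ENNReal.ofReal_rpow_of_pos hx0,
            ← ENNReal.ofReal_mul (by positivity)]
          apply ENNReal.ofReal_le_ofReal
          have h2 : ‖m x‖ ^ (2 : ℝ) = ‖m x‖ ^ (2 - σ) * ‖m x‖ ^ σ := by
            rw [← Real.rpow_add hx0]; ring_nf
          rw [h2]
          gcongr ?_ * _
          exact Real.rpow_le_rpow_of_nonpos hl hx.le (by linarith)
        · rw [Set.indicator_of_notMem (by exact hx)]
          simp
    _ = ENNReal.ofReal (l ^ (2 - σ)) * ∫⁻ x, ‖m x‖ₑ ^ σ ∂μ :=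
        lintegral_const_mul' _ _ ENNReal.ofReal_ne_top
    _ ≤ _ := by
        rw [ENNReal.ofReal_mul (by positivity)]
        gcongr

theorem eLpNorm_mul_two_le_mul_top {X : Type*} [MeasurableSpace X] {μ : Measure X}
    {m h : X → ℂ} (hm : AEStronglyMeasurable m μ) :
    eLpNorm (fun ξ => m ξ * h ξ) 2 μ ≤ eLpNorm m 2 μ * eLpNorm h ∞ μ := by
  have h1 := eLpNorm_smul_le_eLpNorm_mul_eLpNorm_top (𝕜 := ℂ) 2 h hm
  exact h1

/-- A product `m h` split at height `l` of `|m|`: above `l`, pair `m` in `L²` with `h` in `L^∞`; below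
`l`, use `|m| ≤ l`. -/
theorem eLpNorm_mul_le_of_height {X : Type*} [MeasurableSpace X] {μ : Measure X}
    {m h : X → ℂ} (hm : AEStronglyMeasurable m μ) (hh : AEStronglyMeasurable h μ)
    {σ : ℝ} (hσ : 2 ≤ σ) {l B : ℝ} (hl : 0 < l) (hB : 0 < B)
    (hmB : eLpNorm m (ENNReal.ofReal σ) μ ≤ ENNReal.ofReal B) :
    eLpNorm (fun ξ => m ξ * h ξ) 2 μ ≤
      ENNReal.ofReal ((l ^ (2 - σ) * B ^ σ) ^ (1 / 2 : ℝ)) * eLpNorm h ∞ μ +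
        ENNReal.ofReal l * eLpNorm h 2 μ := by
  set S := {x | l < ‖m x‖} with hS
  have hSm : NullMeasurableSet S μ :=
    nullMeasurableSet_lt aemeasurable_const hm.norm.aemeasurable
  have hsplit : (fun ξ => m ξ * h ξ) =
      (fun ξ => S.indicator m ξ * h ξ) + fun ξ => Sᶜ.indicator m ξ * h ξ := by
    ext ξ
    by_cases hξ : ξ ∈ S <;> simp [hξ]
  have h1m : AEStronglyMeasurable (S.indicator m) μ := hm.indicator₀ hSm
  have h2m : AEStronglyMeasurable (Sᶜ.indicator m) μ := hm.indicator₀ hSm.compl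
  calc eLpNorm (fun ξ => m ξ * h ξ) 2 μ
      ≤ eLpNorm (fun ξ => S.indicator m ξ * h ξ) 2 μ +
        eLpNorm (fun ξ => Sᶜ.indicator m ξ * h ξ) 2 μ := by
        rw [hsplit]
        exact eLpNorm_add_le (h1m.mul hh) (h2m.mul hh) (by norm_num)
    _ ≤ eLpNorm (S.indicator m) 2 μ * eLpNorm h ∞ μ + ENNReal.ofReal l * eLpNorm h 2 μ := by
        refine add_le_add (eLpNorm_mul_two_le_mul_top h1m)
          (eLpNorm_le_mul_eLpNorm_of_ae_le_mul (Filter.Eventually.of_forall fun ξ => ?_) 2)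
        rw [norm_mul]
        gcongr
        by_cases hξ : ξ ∈ S
        · simp [hξ, hl.le]
        · rw [Set.indicator_of_mem (by exact hξ)]
          exact not_lt.1 hξ
    _ ≤ _ := by
        gcongr
        exact eLpNorm_two_indicator_lt_norm_le hσ hl hB hmB

section KatoSeilerSimon

variable {E : Type*} [NormedAddCommGroup E] [InnerProductSpace ℝ E] [FiniteDimensional ℝ E]
  [MeasurableSpace E] [BorelSpace E]

/-- The bound before optimizing in the height `l`. The part of the symbol above `l` uses that `V f` is
in `L¹`, so that its Fourier transform is bounded; the part below uses that `V f` is in `L²`. -/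
theorem enorm_fourierMul_mulLp_le_of_height {m V : E → ℂ} (hm : MemLp m ∞ (volume : Measure E))
    (hV : MemLp V ∞ (volume : Measure E)) {K : Set E} (hK : MeasurableSet K)
    (hKfin : volume K ≠ ∞) {M : ℝ} (hM : 0 ≤ M)
    (hVK : ∀ᵐ x, ‖V x‖ ≤ K.indicator (fun _ => M) x) {σ : ℝ} (hσ : 2 ≤ σ)
    {l B : ℝ} (hl : 0 < l) (hB : 0 < B)
    (hmB : eLpNorm m (ENNReal.ofReal σ) volume ≤ ENNReal.ofReal B)
    (f : Lp ℂ 2 (volume : Measure E)) :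
    ‖fourierMul hm (mulLp hV f)‖ₑ ≤ ENNReal.ofReal
      ((l ^ (2 - σ) * B ^ σ) ^ (1 / 2 : ℝ) * (M * (volume K).toReal ^ (1 / 2 : ℝ)) + l * M) *
        ‖f‖ₑ := by
  set a := (volume K).toReal with ha
  have ha0 : 0 ≤ a := ENNReal.toReal_nonneg
  have hV2 : eLpNorm V 2 volume ≤ ENNReal.ofReal (M * a ^ (1 / 2 : ℝ)) := by
    calc eLpNorm V 2 volume ≤ eLpNorm (K.indicator fun _ => M) 2 volume := by
          refine eLpNorm_mono_ae ?_
          filter_upwards [hVK] with x hx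
          exact hx.trans (le_abs_self _)
      _ = ‖M‖ₑ * volume K ^ (1 / (2 : ℝ≥0∞).toReal) :=
          eLpNorm_indicator_const hK (by norm_num) (by norm_num)
      _ = _ := by
          rw [ENNReal.ofReal_mul hM, Real.enorm_eq_ofReal hM,
            ← ENNReal.ofReal_rpow_of_nonneg ha0 (by norm_num), ENNReal.ofReal_toReal hKfin,
            ENNReal.toReal_ofNat]
  have hVf1 : eLpNorm (fun x => V x * f x) 1 volume ≤
      ENNReal.ofReal (M * a ^ (1 / 2 : ℝ)) * ‖f‖ₑ := by
    rw [Lp.enorm_def]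
    refine (eLpNorm_smul_le_mul_eLpNorm (p := 2) (q := 2) (r := 1) (Lp.memLp f).1 hV.1).trans ?_
    gcongr
  have hVf2 : MemLp (fun x => V x * f x) 2 volume :=
    (memLp_congr_ae (coeFn_mulLp hV f)).1 (Lp.memLp _)
  have hVfm : MemLp (fun x => V x * f x) 1 volume :=
    ⟨hVf2.1, hVf1.trans_lt (ENNReal.mul_lt_top ENNReal.ofReal_lt_top enorm_lt_top)⟩
  have hVfe : mulLp hV f = hVf2.toLp _ := by
    apply Lp.ext
    filter_upwards [coeFn_mulLp hV f, hVf2.coeFn_toLp] with x h1 h2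
    rw [h1, h2]
  set h : Lp ℂ 2 (volume : Measure E) := 𝓕 (mulLp hV f) with hh
  have hhtop : eLpNorm h ∞ volume ≤ ENNReal.ofReal (M * a ^ (1 / 2 : ℝ)) * ‖f‖ₑ := by
    rw [hh, hVfe, eLpNorm_congr_ae (coeFn_fourier_toLp hVfm hVf2)]
    exact (eLpNorm_fourier_top_le hVfm).trans hVf1
  have hh2 : eLpNorm h 2 volume ≤ ENNReal.ofReal M * ‖f‖ₑ := by
    rw [← Lp.enorm_def, hh, enorm_fourier_eq, enorm_mulLp, Lp.enorm_def]
    refine eLpNorm_le_mul_eLpNorm_of_ae_le_mul ?_ 2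
    filter_upwards [hVK] with x hx
    rw [norm_mul]
    gcongr
    exact hx.trans (Set.indicator_le_self' (fun _ _ => hM) x)
  rw [enorm_fourierMul, ← hh]
  calc eLpNorm (fun ξ => m ξ * h ξ) 2 volume
      ≤ ENNReal.ofReal ((l ^ (2 - σ) * B ^ σ) ^ (1 / 2 : ℝ)) * eLpNorm h ∞ volume +
        ENNReal.ofReal l * eLpNorm h 2 volume :=
        eLpNorm_mul_le_of_height hm.1 (Lp.memLp h).1 hσ hl hB hmB
    _ ≤ ENNReal.ofReal ((l ^ (2 - σ) * B ^ σ) ^ (1 / 2 : ℝ)) *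
          (ENNReal.ofReal (M * a ^ (1 / 2 : ℝ)) * ‖f‖ₑ) +
        ENNReal.ofReal l * (ENNReal.ofReal M * ‖f‖ₑ) := by
        gcongr
    _ = _ := by
        rw [ENNReal.ofReal_add (by positivity) (by positivity),
          ENNReal.ofReal_mul (p := (l ^ (2 - σ) * B ^ σ) ^ (1 / 2 : ℝ)) (by positivity),
          ENNReal.ofReal_mul (p := l) hl.le]
        ring

/-- A Kato–Seiler–Simon type bound: multiplication by a function `V` with `|V| ≤ M` on `K` and
`V = 0` off `K`, followed by the Fourier multiplier with symbol `m ∈ L^σ`, `σ ≥ 2`, has operator norm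
at most `2 M |K|^(1/σ) ‖m‖_σ`. -/
theorem norm_fourierMul_mulLp_le {m V : E → ℂ} (hm : MemLp m ∞ (volume : Measure E))
    (hV : MemLp V ∞ (volume : Measure E)) {K : Set E} (hK : MeasurableSet K)
    (hKfin : volume K ≠ ∞) {M : ℝ} (hM : 0 ≤ M)
    (hVK : ∀ᵐ x, ‖V x‖ ≤ K.indicator (fun _ => M) x) {σ : ℝ} (hσ : 2 ≤ σ)
    {B : ℝ} (hB : 0 < B) (hmB : eLpNorm m (ENNReal.ofReal σ) volume ≤ ENNReal.ofReal B)
    (f : Lp ℂ 2 (volume : Measure E)) :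
    ‖fourierMul hm (mulLp hV f)‖ ≤ 2 * M * (volume K).toReal ^ (1 / σ) * B * ‖f‖ := by
  set a := (volume K).toReal with ha
  have ha0 : 0 ≤ a := ENNReal.toReal_nonneg
  rcases ha0.eq_or_lt with h0 | h0
  -- if `|K| = 0` the balancing height below would vanish, but then `V = 0` almost everywhere
  · have hK0 : volume K = 0 := by
      rw [ha] at h0
      exact ((ENNReal.toReal_eq_zero_iff _).1 h0.symm).resolve_right hKfin
    have hz : mulLp hV f = 0 := by
      apply Lp.ext
      filter_upwards [coeFn_mulLp hV f, hVK, measure_eq_zero_iff_ae_notMem.1 hK0,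
        Lp.coeFn_zero ℂ 2 (volume : Measure E)] with x h1 h2 h3 h4
      rw [Set.indicator_of_notMem h3] at h2
      rw [h1, h4, norm_le_zero_iff.1 h2]
      simp
    rw [hz, map_zero, norm_zero]
    positivity
  -- this height balances the two parts of the symbol
  set l := a ^ (1 / σ) * B with hl
  have hl0 : 0 < l := by positivity
  have h := enorm_fourierMul_mulLp_le_of_height hm hV hK hKfin hM hVK hσ hl0 hB hmB f
  rw [← ha] at h
  have hkey : (l ^ (2 - σ) * B ^ σ) ^ (1 / 2 : ℝ) * (M * a ^ (1 / 2 : ℝ)) = l * M := by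
    have h1 : l ^ (2 - σ) * B ^ σ * a = l ^ (2 : ℝ) := by
      have h2 : l ^ σ = a * B ^ σ := by
        rw [hl, Real.mul_rpow (by positivity) hB.le, ← Real.rpow_mul ha0, one_div,
          inv_mul_cancel₀ (by linarith), Real.rpow_one]
      calc l ^ (2 - σ) * B ^ σ * a = l ^ (2 - σ) * l ^ σ := by rw [h2]; ring
        _ = l ^ (2 : ℝ) := by rw [← Real.rpow_add hl0]; ring_nf
    calc _ = ((l ^ (2 - σ) * B ^ σ) ^ (1 / 2 : ℝ) * a ^ (1 / 2 : ℝ)) * M := by ring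
      _ = _ := by
        rw [← Real.mul_rpow (by positivity) ha0, h1, ← Real.rpow_mul hl0.le]
        norm_num
  rw [hkey, ← ofReal_norm, ← ofReal_norm, ← ENNReal.ofReal_mul (by positivity)] at h
  refine ((ENNReal.ofReal_le_ofReal_iff (by positivity)).1 h).trans (le_of_eq ?_)
  rw [hl]
  ring

/-- The bound of `norm_fourierMul_mulLp_le` with the two operators in the other order, by
duality. -/
theorem norm_mulLp_fourierMul_le {m V : E → ℂ} (hm : MemLp m ∞ (volume : Measure E))
    (hV : MemLp V ∞ (volume : Measure E)) {K : Set E} (hK : MeasurableSet K)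
    (hKfin : volume K ≠ ∞) {M : ℝ} (hM : 0 ≤ M)
    (hVK : ∀ᵐ x, ‖V x‖ ≤ K.indicator (fun _ => M) x) {σ : ℝ} (hσ : 2 ≤ σ)
    {B : ℝ} (hB : 0 < B) (hmB : eLpNorm m (ENNReal.ofReal σ) volume ≤ ENNReal.ofReal B)
    (f : Lp ℂ 2 (volume : Measure E)) :
    ‖mulLp hV (fourierMul hm f)‖ ≤ 2 * M * (volume K).toReal ^ (1 / σ) * B * ‖f‖ := by
  set c := 2 * M * (volume K).toReal ^ (1 / σ) * B with hc
  have hc0 : 0 ≤ c := by positivity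
  set g := mulLp hV (fourierMul hm f) with hg
  have hb : ‖fourierMul (memLp_top_star hm) (mulLp (memLp_top_star hV) g)‖ ≤ c * ‖g‖ := by
    refine norm_fourierMul_mulLp_le _ _ hK hKfin hM ?_ hσ hB ?_ g
    · simpa using hVK
    · refine (le_of_eq (eLpNorm_congr_norm_ae ?_)).trans hmB
      simp
  have h1 : ‖g‖ * ‖g‖ ≤ c * ‖f‖ * ‖g‖ := by
    have h2 : inner ℂ g g =
        inner ℂ f (fourierMul (memLp_top_star hm) (mulLp (memLp_top_star hV) g)) := by
      conv_lhs => rw [hg]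
      rw [inner_mulLp_left, inner_fourierMul_left]
    calc ‖g‖ * ‖g‖ = ‖inner ℂ g g‖ := by rw [inner_self_eq_norm_sq_to_K]; simp [sq]
      _ ≤ ‖f‖ * ‖fourierMul (memLp_top_star hm) (mulLp (memLp_top_star hV) g)‖ := by
          rw [h2]; exact norm_inner_le_norm _ _
      _ ≤ ‖f‖ * (c * ‖g‖) := by gcongr
      _ = _ := by ring
  rcases (norm_nonneg g).eq_or_lt with h0 | h0
  · rw [← h0]; positivity
  · exact le_of_mul_le_mul_right h1 h0

end KatoSeilerSimon

/-! ### The symbol of the resolvent -/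

section ResolventSymbol

variable {E : Type*} [NormedAddCommGroup E]

/-- The symbol `(4π²|ξ|² + z)⁻¹` of `(-Δ + z)⁻¹`, for the Fourier transform with kernel
`exp (-2πi x·ξ)`. -/
noncomputable def resolventSymbol (z : ℂ) (ξ : E) : ℂ :=
  (((2 * Real.pi) ^ 2 * ‖ξ‖ ^ 2 : ℝ) + z)⁻¹

theorem add_norm_le_two_mul_norm_add {k : ℝ} (hk : 0 ≤ k) {z : ℂ} (hz : 0 ≤ z.re) :
    k + ‖z‖ ≤ 2 * ‖(k : ℂ) + z‖ := by
  have h1 : k ≤ ‖(k : ℂ) + z‖ := by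
    refine le_trans ?_ (Complex.re_le_norm _)
    simp [hz]
  have h2 : ‖z‖ ≤ ‖(k : ℂ) + z‖ := by
    rw [← sq_le_sq₀ (norm_nonneg _) (norm_nonneg _), Complex.sq_norm, Complex.sq_norm,
      Complex.normSq_apply, Complex.normSq_apply]
    simp
    nlinarith [mul_nonneg hk hz]
  linarith

theorem norm_resolventSymbol_le {z : ℂ} (hz : 0 ≤ z.re) (hz0 : z ≠ 0) (ξ : E) :
    ‖resolventSymbol z ξ‖ ≤ 2 * (‖z‖ + ‖ξ‖ ^ 2)⁻¹ := by
  have hzn : 0 < ‖z‖ := norm_pos_iff.2 hz0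
  have hpi : 1 ≤ (2 * Real.pi) ^ 2 := by nlinarith [Real.pi_gt_three]
  have h := add_norm_le_two_mul_norm_add (k := (2 * Real.pi) ^ 2 * ‖ξ‖ ^ 2) (by positivity) hz
  have h' : ‖z‖ + ‖ξ‖ ^ 2 ≤ 2 * ‖(((2 * Real.pi) ^ 2 * ‖ξ‖ ^ 2 : ℝ) : ℂ) + z‖ := by
    nlinarith [sq_nonneg ‖ξ‖]
  have hpos : 0 < ‖z‖ + ‖ξ‖ ^ 2 := by positivity
  rw [resolventSymbol, norm_inv]
  calc _ ≤ ((‖z‖ + ‖ξ‖ ^ 2) / 2)⁻¹ := by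
        gcongr
        linarith
    _ = _ := by rw [inv_div]; rfl

theorem symbol_ne_zero {z : ℂ} (hz : 0 ≤ z.re) (hz0 : z ≠ 0) (ξ : E) :
    (((2 * Real.pi) ^ 2 * ‖ξ‖ ^ 2 : ℝ) : ℂ) + z ≠ 0 := by
  intro h0
  have h := add_norm_le_two_mul_norm_add (k := (2 * Real.pi) ^ 2 * ‖ξ‖ ^ 2) (by positivity) hz
  rw [h0, norm_zero, mul_zero] at h
  have hzn : 0 < ‖z‖ := norm_pos_iff.2 hz0
  have : 0 ≤ (2 * Real.pi) ^ 2 * ‖ξ‖ ^ 2 := by positivity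
  linarith

variable [InnerProductSpace ℝ E] [FiniteDimensional ℝ E] [MeasurableSpace E] [BorelSpace E]

theorem memLp_top_resolventSymbol {z : ℂ} (hz : 0 ≤ z.re) (hz0 : z ≠ 0) :
    MemLp (resolventSymbol z) ∞ (volume : Measure E) := by
  have hzn : 0 < ‖z‖ := norm_pos_iff.2 hz0
  refine memLp_top_of_bound ?_ (2 * ‖z‖⁻¹) (Filter.Eventually.of_forall fun ξ => ?_)
  · apply Continuous.aestronglyMeasurable
    exact Continuous.inv₀ (by fun_prop) (symbol_ne_zero hz hz0)
  · refine (norm_resolventSymbol_le hz hz0 ξ).trans ?_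
    gcongr
    simp

/-- The symbol is in `L^σ` for `σ > n/2`, with norm `O(|z| ^ (n/(2σ) - 1))` uniformly in the closed
right half-plane: substitute `ξ = |z| ^ (1/2) η` in `∫ (|z| + |ξ|²) ^ (-σ)`. -/
theorem exists_eLpNorm_resolventSymbol_le {σ : ℝ} (hσ : (Module.finrank ℝ E : ℝ) < 2 * σ) :
    ∃ c : ℝ, 0 < c ∧ ∀ z : ℂ, 0 ≤ z.re → z ≠ 0 →
      eLpNorm (resolventSymbol z) (ENNReal.ofReal σ) (volume : Measure E) ≤
        ENNReal.ofReal (c * ‖z‖ ^ ((Module.finrank ℝ E : ℝ) / (2 * σ) - 1)) := by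
  set n := Module.finrank ℝ E with hn
  have hσ0 : 0 < σ := by
    have : (0 : ℝ) ≤ n := Nat.cast_nonneg _
    linarith
  have hσ0' : ENNReal.ofReal σ ≠ 0 := by simp [hσ0]
  set J := ∫ x : E, (1 + ‖x‖ ^ 2) ^ (-σ) with hJ
  have hint : Integrable fun x : E => (1 + ‖x‖ ^ 2) ^ (-σ) := by
    have h := integrable_rpow_neg_one_add_norm_sq (E := E) (μ := volume) hσ
    convert h using 3
    ring
  have hJ0 : 0 ≤ J := integral_nonneg fun x => by positivity
  refine ⟨2 * J ^ (1 / σ) + 1, by positivity, fun z hz hz0 => ?_⟩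
  have hzn : 0 < ‖z‖ := norm_pos_iff.2 hz0
  set ρ := ‖z‖ with hρ
  set t := ρ ^ (1 / 2 : ℝ) with ht
  have ht0 : 0 < t := by positivity
  have ht2 : t ^ 2 = ρ := by
    rw [ht, ← Real.rpow_natCast, ← Real.rpow_mul hzn.le]; norm_num
  have hfun : ∀ x : E, (ρ + ‖x‖ ^ 2) ^ (-σ) = ρ ^ (-σ) * (1 + ‖t⁻¹ • x‖ ^ 2) ^ (-σ) := by
    intro x
    rw [← Real.mul_rpow hzn.le (by positivity), norm_smul, mul_pow, norm_inv, inv_pow,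
      Real.norm_of_nonneg ht0.le, ht2]
    congr 1
    field_simp
  -- the exponent `n/2` is the Jacobian `t ^ n` of the scaling, with `t = ρ ^ (1/2)`
  have hval : ∫ x : E, (ρ + ‖x‖ ^ 2) ^ (-σ) = ρ ^ (n / 2 - σ) * J := by
    simp_rw [hfun]
    rw [integral_const_mul, Measure.integral_comp_smul volume
      (fun x : E => (1 + ‖x‖ ^ 2) ^ (-σ)) t⁻¹, ← hn, ← hJ, smul_eq_mul, ← mul_assoc]
    congr 1
    rw [inv_pow, inv_inv, abs_of_pos (by positivity), ht, ← Real.rpow_natCast,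
      ← Real.rpow_mul hzn.le, ← Real.rpow_add hzn]
    ring_nf
  have hint' : Integrable fun x : E => (ρ + ‖x‖ ^ 2) ^ (-σ) := by
    simp_rw [hfun]
    exact (hint.comp_smul (inv_ne_zero ht0.ne')).const_mul _
  rw [eLpNorm_eq_lintegral_rpow_enorm_toReal hσ0' ENNReal.ofReal_ne_top,
    ENNReal.toReal_ofReal hσ0.le]
  have hle : ∫⁻ ξ : E, ‖resolventSymbol z ξ‖ₑ ^ σ ≤
      ENNReal.ofReal (2 ^ σ * (ρ ^ (n / 2 - σ) * J)) := by
    calc ∫⁻ ξ : E, ‖resolventSymbol z ξ‖ₑ ^ σ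
        ≤ ∫⁻ ξ : E, ENNReal.ofReal (2 ^ σ * (ρ + ‖ξ‖ ^ 2) ^ (-σ)) := by
          refine lintegral_mono fun ξ => ?_
          rw [← ofReal_norm, ENNReal.ofReal_rpow_of_nonneg (norm_nonneg _) hσ0.le]
          apply ENNReal.ofReal_le_ofReal
          calc ‖resolventSymbol z ξ‖ ^ σ ≤ (2 * (ρ + ‖ξ‖ ^ 2)⁻¹) ^ σ := by
                gcongr
                exact norm_resolventSymbol_le hz hz0 ξ
            _ = _ := by
                rw [Real.mul_rpow (by norm_num) (by positivity), Real.inv_rpow (by positivity),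
                  Real.rpow_neg (by positivity)]
      _ = ENNReal.ofReal (∫ ξ : E, 2 ^ σ * (ρ + ‖ξ‖ ^ 2) ^ (-σ)) :=
          (ofReal_integral_eq_lintegral_ofReal (hint'.const_mul _)
            (Filter.Eventually.of_forall fun x => by positivity)).symm
      _ = _ := by rw [integral_const_mul, hval]
  refine (ENNReal.rpow_le_rpow hle (by positivity)).trans ?_
  rw [ENNReal.ofReal_rpow_of_nonneg (by positivity) (by positivity)]
  apply ENNReal.ofReal_le_ofReal
  rw [Real.mul_rpow (by positivity) (by positivity), Real.mul_rpow (by positivity) hJ0,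
    ← Real.rpow_mul (by norm_num), ← Real.rpow_mul hzn.le, mul_one_div_cancel hσ0.ne',
    Real.rpow_one]
  have he : ((n : ℝ) / 2 - σ) * (1 / σ) = n / (2 * σ) - 1 := by field_simp
  rw [he]
  have : 0 < ρ ^ ((n : ℝ) / (2 * σ) - 1) := by positivity
  nlinarith

end ResolventSymbol

/-! ### The distributional Laplacian on the Fourier side -/

section Resolvent

variable {E : Type*} [NormedAddCommGroup E] [InnerProductSpace ℝ E] [FiniteDimensional ℝ E]
  [MeasurableSpace E] [BorelSpace E]

/-- For square-integrable `u` and `w`, the distributional identity `g u = w` holds if and only if it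
holds almost everywhere. -/
theorem smulLeftCLM_toTemperedDistribution_eq_iff {g : E → ℂ} (hg : g.HasTemperateGrowth)
    (u w : Lp ℂ 2 (volume : Measure E)) :
    TemperedDistribution.smulLeftCLM ℂ g (u : 𝓢'(E, ℂ)) = (w : 𝓢'(E, ℂ)) ↔
      ∀ᵐ ξ, g ξ * u ξ = w ξ := by
  have happ : ∀ φ : 𝓢(E, ℂ), TemperedDistribution.smulLeftCLM ℂ g (u : 𝓢'(E, ℂ)) φ =
      ∫ x, φ x * (g x * u x) := by
    intro φ
    rw [TemperedDistribution.smulLeftCLM_apply_apply, Lp.toTemperedDistribution_apply]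
    congr 1 with x
    simp [SchwartzMap.smulLeftCLM_apply_apply hg]
    ring
  constructor
  · intro h
    apply ae_eq_of_integral_contDiff_smul_eq
    · have hu : LocallyIntegrable u := (Lp.memLp u).locallyIntegrable (by norm_num)
      rw [← locallyIntegrableOn_univ] at hu ⊢
      exact hu.continuousOn_mul hg.1.continuous.continuousOn isClosed_univ.isLocallyClosed
    · exact (Lp.memLp _).locallyIntegrable (by norm_num)
    intro φ φ_smooth φ_cpt
    have hφ₁ : HasCompactSupport (Complex.ofRealCLM ∘ φ) := φ_cpt.comp_left rfl
    have hφ₂ : ContDiff ℝ (⊤ : ℕ∞) (Complex.ofRealCLM ∘ φ) := by fun_prop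
    have h' := congrArg (fun T : 𝓢'(E, ℂ) => T (hφ₁.toSchwartzMap hφ₂)) h
    simp only [happ, Lp.toTemperedDistribution_apply] at h'
    simpa using h'
  · intro h
    ext φ
    rw [happ, Lp.toTemperedDistribution_apply]
    apply integral_congr_ae
    filter_upwards [h] with x hx
    rw [hx, smul_eq_mul]

theorem coeFn_fourier_sub (f g : Lp ℂ 2 (volume : Measure E)) :
    (𝓕 (f - g) : Lp ℂ 2 (volume : Measure E)) =ᵐ[volume]
      fun ξ => (𝓕 f : Lp ℂ 2 (volume : Measure E)) ξ - (𝓕 g : Lp ℂ 2 (volume : Measure E)) ξ := by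
  have h : 𝓕 (f - g) = 𝓕 f - 𝓕 g := (Lp.fourierTransformₗᵢ E ℂ).map_sub f g
  rw [h]
  exact Lp.coeFn_sub _ _

theorem coeFn_fourier_smul (c : ℂ) (f : Lp ℂ 2 (volume : Measure E)) :
    (𝓕 (c • f) : Lp ℂ 2 (volume : Measure E)) =ᵐ[volume]
      fun ξ => c * (𝓕 f : Lp ℂ 2 (volume : Measure E)) ξ := by
  have h : 𝓕 (c • f) = c • 𝓕 f := (Lp.fourierTransformₗᵢ E ℂ).map_smul c f
  rw [h]
  exact Lp.coeFn_smul _ _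

theorem laplacian_toTemperedDistribution_eq_iff (v w : Lp ℂ 2 (volume : Measure E)) :
    Δ (v : 𝓢'(E, ℂ)) = (w : 𝓢'(E, ℂ)) ↔
      ∀ᵐ ξ, -(((2 * Real.pi) ^ 2 * ‖ξ‖ ^ 2 : ℝ) : ℂ) *
        (𝓕 v : Lp ℂ 2 (volume : Measure E)) ξ = (𝓕 w : Lp ℂ 2 (volume : Measure E)) ξ := by
  have hg : (fun ξ : E => ((‖ξ‖ ^ 2 : ℝ) : ℂ)).HasTemperateGrowth := by fun_prop
  have h1 : 𝓕 (Δ (v : 𝓢'(E, ℂ))) = TemperedDistribution.smulLeftCLM ℂ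
      (fun ξ : E => -(((2 * Real.pi) ^ 2 * ‖ξ‖ ^ 2 : ℝ) : ℂ))
      ((𝓕 v : Lp ℂ 2 (volume : Measure E)) : 𝓢'(E, ℂ)) := by
    rw [TemperedDistribution.laplacian_eq_fourierMultiplierCLM,
      ← Lp.fourier_toTemperedDistribution_eq,
      show (fun ξ : E => -(((2 * Real.pi) ^ 2 * ‖ξ‖ ^ 2 : ℝ) : ℂ)) =
        ((-(2 * Real.pi) ^ 2 : ℝ) : ℂ) • fun ξ : E => ((‖ξ‖ ^ 2 : ℝ) : ℂ) by
          ext ξ; simp,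
      TemperedDistribution.smulLeftCLM_smul hg, ← Complex.coe_smul,
      FourierTransform.fourier_smul, TemperedDistribution.fourierMultiplierCLM_apply,
      FourierTransform.fourier_fourierInv_eq]
    rfl
  rw [← smulLeftCLM_toTemperedDistribution_eq_iff (by fun_prop), ← h1,
    ← Lp.fourier_toTemperedDistribution_eq]
  exact ⟨fun h => by rw [h], fun h => by simpa using congrArg (fun T : 𝓢'(E, ℂ) => 𝓕⁻ T) h⟩

end Resolvent

/-! ### The inverse of `-Δ + V` -/

section Inverse

variable {d : ℕ}

theorem SolvesNegLaplacianAdd.congr {V V' : Space d → ℂ} {f f' v : L2 d}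
    (h : SolvesNegLaplacianAdd V f v)
    (hV : ∀ᵐ x, V' x * v x - f' x = V x * v x - f x) : SolvesNegLaplacianAdd V' f' v := by
  obtain ⟨h1, w, h2, h3⟩ := h
  refine ⟨h1, w, h2, ?_⟩
  filter_upwards [hV, h3] with x hx hx'
  linear_combination hx + hx'

theorem IsInverseNegLaplacianAdd.congr {V V' : Space d → ℂ} {R : L2 d →L[ℂ] L2 d}
    (h : IsInverseNegLaplacianAdd V R) (hV : V =ᵐ[volume] V') : IsInverseNegLaplacianAdd V' R := by
  intro f v
  rw [h f v]
  constructor <;> intro hs <;> refine hs.congr ?_ <;> filter_upwards [hV] with x hx <;> rw [hx]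

/-- On the Fourier side, `-Δ v + z v = f` is the pointwise equation `(4π²|ξ|² + z) v̂ = f̂`. -/
theorem solvesNegLaplacianAdd_const_iff (z : ℂ) (f v : L2 d) :
    SolvesNegLaplacianAdd (fun _ => z) f v ↔
      ∀ᵐ ξ, ((((2 * Real.pi) ^ 2 * ‖ξ‖ ^ 2 : ℝ) : ℂ) + z) * (𝓕 v : L2 d) ξ = (𝓕 f : L2 d) ξ := by
  -- `w` is the only candidate for `Δ v`
  set w : L2 d := z • v - f with hw
  have hwx : w =ᵐ[volume] fun x => z * v x - f x := by
    filter_upwards [Lp.coeFn_sub (z • v) f, Lp.coeFn_smul z v] with x h1 h2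
    rw [hw, h1, Pi.sub_apply, h2, Pi.smul_apply, smul_eq_mul]
  have hwξ : (𝓕 w : L2 d) =ᵐ[volume] fun ξ => z * (𝓕 v : L2 d) ξ - (𝓕 f : L2 d) ξ := by
    filter_upwards [coeFn_fourier_sub (z • v) f, coeFn_fourier_smul z v] with x h1 h2
    rw [hw, h1, h2]
  have hΔ : Δ (v : 𝓢'(Space d, ℂ)) = (w : 𝓢'(Space d, ℂ)) ↔
      ∀ᵐ ξ, ((((2 * Real.pi) ^ 2 * ‖ξ‖ ^ 2 : ℝ) : ℂ) + z) * (𝓕 v : L2 d) ξ =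
        (𝓕 f : L2 d) ξ := by
    rw [laplacian_toTemperedDistribution_eq_iff]
    constructor <;> intro h <;> filter_upwards [h, hwξ] with ξ h1 h2
    · rw [h2] at h1
      linear_combination -h1
    · rw [h2]
      linear_combination -h1
  rw [← hΔ]
  constructor
  · rintro ⟨-, w', h2, h3⟩
    have : w' = w := by
      apply Lp.ext
      filter_upwards [h3, hwx] with x h4 h5
      rw [h5]
      linear_combination -h4
    rw [h2, this]
  · intro h
    refine ⟨?_, w, h, ?_⟩
    · rw [TemperedDistribution.memSobolev_iff_exists_smulLeftCLM_fourier]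
      have hξ := hΔ.1 h
      set c : ℂ := (((2 * Real.pi) ^ 2 : ℝ) : ℂ) with hc
      have hc0 : c ≠ 0 := by
        rw [hc]
        exact_mod_cast (by positivity : ((2 * Real.pi) ^ 2 : ℝ) ≠ 0)
      refine ⟨𝓕 v + c⁻¹ • (𝓕 f - z • 𝓕 v), ?_⟩
      rw [Lp.fourier_toTemperedDistribution_eq,
        smulLeftCLM_toTemperedDistribution_eq_iff (by fun_prop)]
      filter_upwards [hξ, Lp.coeFn_add (𝓕 v) (c⁻¹ • (𝓕 f - z • 𝓕 v)),
        Lp.coeFn_smul c⁻¹ (𝓕 f - z • 𝓕 v), Lp.coeFn_sub (𝓕 f) (z • 𝓕 v),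
        Lp.coeFn_smul z (𝓕 v)] with ξ h1 h2 h3 h4 h5
      rw [h2, Pi.add_apply, h3, Pi.smul_apply, h4, Pi.sub_apply, h5, Pi.smul_apply, smul_eq_mul,
        smul_eq_mul, ← h1]
      norm_num
      rw [hc]
      push_cast
      rw [hc] at hc0
      push_cast at hc0
      field_simp
      ring
    · filter_upwards [hwx] with x hx
      rw [hx]
      ring

/-- The Fourier multiplier with symbol `(4π²|ξ|² + z)⁻¹` is `(-Δ + z)⁻¹`. -/
theorem isInverseNegLaplacianAdd_const {z : ℂ} (hz : 0 ≤ z.re) (hz0 : z ≠ 0) :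
    IsInverseNegLaplacianAdd (fun _ : Space d => z)
      (fourierMul (memLp_top_resolventSymbol hz hz0)) := by
  intro f v
  rw [solvesNegLaplacianAdd_const_iff,
    ← (Lp.fourierTransformₗᵢ (Space d) ℂ).injective.eq_iff]
  change 𝓕 (fourierMul _ f) = 𝓕 v ↔ _
  rw [fourier_fourierMul]
  have hm := coeFn_mulLp (memLp_top_resolventSymbol (E := Space d) hz hz0) (𝓕 f)
  constructor
  · intro h
    rw [h] at hm
    filter_upwards [hm] with ξ h1
    rw [h1, resolventSymbol, mul_inv_cancel_left₀ (symbol_ne_zero hz hz0 ξ)]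
  · intro h
    apply Lp.ext
    filter_upwards [hm, h] with ξ h1 h2
    rw [h1, ← h2, resolventSymbol, inv_mul_cancel_left₀ (symbol_ne_zero hz hz0 ξ)]

/-- If `R = (-Δ + z)⁻¹` and `‖R W‖ ≤ 1/2`, then `(-Δ + z - W)⁻¹ = (1 - R W)⁻¹ R`, by a Neumann
series. -/
theorem exists_isInverseNegLaplacianAdd_of_perturbation {z : ℂ} {R : L2 d →L[ℂ] L2 d}
    (hR : IsInverseNegLaplacianAdd (fun _ => z) R) {V W : Space d → ℂ} (hW : MemLp W ∞ volume)
    (hVW : ∀ᵐ x, V x = z - W x) (hT : ∀ f, ‖R (mulLp hW f)‖ ≤ 2⁻¹ * ‖f‖) :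
    ∃ S : L2 d →L[ℂ] L2 d, IsInverseNegLaplacianAdd V S ∧ ∀ f, ‖S f‖ ≤ 2 * ‖R f‖ := by
  set T : L2 d →L[ℂ] L2 d := R ∘L mulLp hW with hTdef
  have hTn : ‖T‖ < 1 :=
    (ContinuousLinearMap.opNorm_le_bound T (by norm_num) hT).trans_lt (by norm_num)
  set U := Units.oneSub T hTn with hU
  have hS : ∀ f v : L2 d, ((U⁻¹ : (L2 d →L[ℂ] L2 d)ˣ) : L2 d →L[ℂ] L2 d) (R f) = v ↔
      R f + T v = v := by
    intro f v
    have h1 : ∀ x, (U : L2 d →L[ℂ] L2 d) x = x - T x := fun x => by simp [hU]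
    have h2 : ∀ x, (U : L2 d →L[ℂ] L2 d) (((U⁻¹ : (L2 d →L[ℂ] L2 d)ˣ) : L2 d →L[ℂ] L2 d) x) = x :=
      fun x => by
        rw [← mul_apply_eq_comp, Units.mul_inv, one_apply_eq_self]
    have h3 : ∀ x, ((U⁻¹ : (L2 d →L[ℂ] L2 d)ˣ) : L2 d →L[ℂ] L2 d) ((U : L2 d →L[ℂ] L2 d) x) = x :=
      fun x => by
        rw [← mul_apply_eq_comp, Units.inv_mul, one_apply_eq_self]
    constructor
    · intro h
      have h4 := h2 (R f)
      rw [h, h1] at h4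
      rw [← h4]; abel
    · intro h
      rw [← h3 v, h1, ← h]
      congr 1
      rw [h]
      exact (sub_eq_of_eq_add h.symm).symm
  refine ⟨((U⁻¹ : (L2 d →L[ℂ] L2 d)ˣ) : L2 d →L[ℂ] L2 d) ∘L R, fun f v => ?_, fun f => ?_⟩
  · rw [ContinuousLinearMap.comp_apply, hS]
    have hadd : R f + T v = R (f + mulLp hW v) := by rw [map_add]; rfl
    rw [hadd, hR]
    have hae : ∀ᵐ x, z * v x - (f + mulLp hW v : L2 d) x = V x * v x - f x := by
      filter_upwards [hVW, Lp.coeFn_add f (mulLp hW v), coeFn_mulLp hW v] with x h1 h2 h3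
      rw [h1, h2, Pi.add_apply, h3]
      ring
    constructor <;> intro hs <;> refine hs.congr ?_ <;> filter_upwards [hae] with x hx
    · exact hx.symm
    · exact hx
  · set v := (((U⁻¹ : (L2 d →L[ℂ] L2 d)ˣ) : L2 d →L[ℂ] L2 d) ∘L R) f with hv
    have h1 : R f + T v = v := (hS f v).1 rfl
    have h2 : ‖v‖ ≤ ‖R f‖ + ‖T v‖ := by
      conv_lhs => rw [← h1]
      exact norm_add_le _ _
    have h3 : ‖T v‖ ≤ 2⁻¹ * ‖v‖ := hT v
    linarith

end Inverse

/-! ### Powers in the sector -/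

section Sector

theorem norm_polar_cpow {r : ℝ} (hr : 0 < r) (β a : ℝ) :
    ‖((r : ℂ) * Complex.exp (β * Complex.I)) ^ (a : ℂ)‖ = r ^ a := by
  rw [Complex.norm_cpow_real]
  simp [Complex.norm_exp_ofReal_mul_I, abs_of_pos hr]

theorem polar_ne_zero {r : ℝ} (hr : 0 < r) (β : ℝ) :
    (r : ℂ) * Complex.exp (β * Complex.I) ≠ 0 :=
  mul_ne_zero (by exact_mod_cast hr.ne') (Complex.exp_ne_zero _)

/-- The principal power `p ^ αs` stays in the closed right half-plane for `p` in the sector. -/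
theorem re_polar_cpow_nonneg {r β αs : ℝ} (hr : 0 < r) (hα : 0 < αs)
    (hβ : β ∈ Icc (-sectorAngle αs) (sectorAngle αs)) :
    0 ≤ (((r : ℂ) * Complex.exp (β * Complex.I)) ^ (αs : ℂ)).re := by
  have hpi := Real.pi_pos
  have h1 : |β| ≤ 2 * Real.pi / 3 := (abs_le.2 hβ).trans (min_le_left _ _)
  have h2 : |β| ≤ Real.pi / 2 * αs⁻¹ := (abs_le.2 hβ).trans (min_le_right _ _)
  have h3 : |αs * β| ≤ Real.pi / 2 := by
    rw [abs_mul, abs_of_pos hα]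
    calc αs * |β| ≤ αs * (Real.pi / 2 * αs⁻¹) := by gcongr
      _ = _ := by field_simp
  have hβ1 := abs_le.1 h1
  have hlog : Complex.log ((r : ℂ) * Complex.exp (β * Complex.I)) =
      (Real.log r : ℂ) + β * Complex.I := by
    rw [Complex.log_ofReal_mul hr (Complex.exp_ne_zero _), Complex.log_exp]
    · simp; linarith
    · simp; linarith
  rw [Complex.cpow_def_of_ne_zero (polar_ne_zero hr β), hlog, Complex.exp_re]
  refine mul_nonneg (Real.exp_pos _).le ?_
  have : (((Real.log r : ℂ) + β * Complex.I) * (αs : ℂ)).im = αs * β := by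
    simp [mul_comm]
  rw [this]
  exact Real.cos_nonneg_of_mem_Icc (abs_le.1 h3)

end Sector

/-! ### The radius of smallness -/

section Radius

variable {d : ℕ} {C₀ s αm αs : ℝ} {K : Set (Space d)}

theorem smallRadius_pos (hK : volume K ≠ ∞) (hs : 0 < s) (hγ : 0 < αm - αs * (1 - d / s)) :
    0 < smallRadius C₀ s K αm αs := by
  refine ENNReal.toReal_pos (ne_of_gt (lt_min one_pos ?_))
    ((min_le_left _ _).trans_lt ENNReal.one_lt_top).ne
  have hX : ENNReal.ofReal (2 * C₀) * (volume K) ^ (2 / s) ≠ ∞ :=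
    ENNReal.mul_ne_top ENNReal.ofReal_ne_top
      (ENNReal.rpow_ne_top_of_nonneg (by positivity) hK)
  have he : -1 / (αm - αs * (1 - d / s)) < 0 := div_neg_of_neg_of_pos (by norm_num) hγ
  rw [pos_iff_ne_zero, Ne, ENNReal.rpow_eq_zero_iff]
  rintro (⟨-, h⟩ | ⟨h, -⟩)
  · linarith
  · exact hX h

theorem lt_one_of_lt_smallRadius {r : ℝ} (hr : r < smallRadius C₀ s K αm αs) : r < 1 :=
  hr.trans_le (ENNReal.toReal_mono ENNReal.one_ne_top (min_le_left _ _))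

theorem mul_rpow_le_of_lt_smallRadius (hC : 0 < C₀)
    (hγ : 0 < αm - αs * (1 - d / s)) {r : ℝ} (hr0 : 0 < r) (hr : r < smallRadius C₀ s K αm αs) :
    C₀ * (volume K).toReal ^ (2 / s) * r ^ (αm - αs * (1 - d / s)) ≤ 2⁻¹ := by
  set γ := αm - αs * (1 - d / s) with hγdef
  have h1 : ENNReal.ofReal r ≤ (ENNReal.ofReal (2 * C₀) * (volume K) ^ (2 / s)) ^ (-1 / γ) := by
    refine le_trans ?_ (min_le_right (1 : ℝ≥0∞) _)
    exact ((ENNReal.ofReal_lt_iff_lt_toReal hr0.le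
      ((min_le_left _ _).trans_lt ENNReal.one_lt_top).ne).2 hr).le
  rw [neg_div, ENNReal.rpow_neg, ENNReal.le_inv_iff_mul_le] at h1
  have h2 := ENNReal.rpow_le_rpow h1 hγ.le
  rw [ENNReal.mul_rpow_of_nonneg _ _ hγ.le, ← ENNReal.rpow_mul, one_div_mul_cancel hγ.ne',
    ENNReal.rpow_one, ENNReal.one_rpow] at h2
  have h3 := ENNReal.toReal_mono ENNReal.one_ne_top h2
  rw [ENNReal.toReal_mul, ENNReal.toReal_mul, ← ENNReal.toReal_rpow, ← ENNReal.toReal_rpow,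
    ENNReal.toReal_ofReal hr0.le, ENNReal.toReal_ofReal (by positivity), ENNReal.toReal_one] at h3
  linarith

end Radius

/-! ### The variable-order coefficient -/

section Order

variable {d : ℕ}

theorem aemeasurable_powOrder {p : ℂ} (hp : p ≠ 0) {α : Space d → ℝ} (hα : AEMeasurable α) :
    AEMeasurable (powOrder p α) := by
  have hcont : Continuous fun a : ℝ => p ^ (a : ℂ) :=
    Continuous.const_cpow Complex.continuous_ofReal (Or.inl hp)
  exact hcont.measurable.comp_aemeasurable hα

theorem aemeasurable_variableOrder {K : Set (Space d)} (hK : MeasurableSet K) (αs : ℝ)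
    {κ : Space d → ℝ} (hκ : AEMeasurable κ (volume.restrict K)) :
    AEMeasurable (variableOrder K αs κ) := by
  have h : variableOrder K αs κ = K.indicator κ + Kᶜ.indicator fun _ => αs := by
    ext x
    by_cases hx : x ∈ K <;> simp [variableOrder, hx]
  rw [h]
  exact ((aemeasurable_indicator_iff hK).2 hκ).add
    ((aemeasurable_indicator_iff hK.compl).2 aemeasurable_const)

/-- The perturbation `p ^ αs - p ^ α` lives on `K` and is bounded there by `2 |p| ^ αm`. -/
theorem norm_sub_powOrder_variableOrder_le {K : Set (Space d)} (hK : MeasurableSet K)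
    {αm αM αs : ℝ} (hms : αm ≤ αs) {κ : Space d → ℝ}
    (hκ : ∀ᵐ x ∂(volume.restrict K), κ x ∈ Icc αm αM) {r : ℝ} (hr : 0 < r) (hr1 : r < 1) (β : ℝ) :
    ∀ᵐ x, ‖((r : ℂ) * Complex.exp (β * Complex.I)) ^ (αs : ℂ) -
        powOrder (r * Complex.exp (β * Complex.I)) (variableOrder K αs κ) x‖ ≤
      K.indicator (fun _ => 2 * r ^ αm) x := by
  filter_upwards [(ae_restrict_iff' hK).1 hκ] with x hx
  by_cases hxK : x ∈ K
  · rw [Set.indicator_of_mem hxK]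
    refine (norm_sub_le _ _).trans ?_
    rw [powOrder, norm_polar_cpow hr, norm_polar_cpow hr, two_mul]
    have h1 : variableOrder K αs κ x = κ x := by simp [variableOrder, hxK]
    rw [h1]
    exact add_le_add (Real.rpow_le_rpow_of_exponent_ge hr hr1.le hms)
      (Real.rpow_le_rpow_of_exponent_ge hr hr1.le (hx hxK).1)
  · simp [powOrder, variableOrder, hxK]

theorem memLp_powOrder_mul {p : ℂ} (hp : p ≠ 0) {α : Space d → ℝ} (hα : AEMeasurable α)
    {a : ℝ} (hp1 : ‖p‖ ≤ 1) (ha : ∀ᵐ x, a ≤ α x) {u : Space d → ℂ} (hu : MemLp u 2 volume) :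
    MemLp (fun x => powOrder p α x * u x) 2 volume := by
  have hmeas := (aemeasurable_powOrder hp hα).aestronglyMeasurable
  refine hu.of_le_mul (c := ‖p‖ ^ a) (hmeas.mul hu.1) ?_
  filter_upwards [ha] with x hx
  rw [norm_mul]
  gcongr
  rw [powOrder, Complex.norm_cpow_real]
  exact Real.rpow_le_rpow_of_exponent_ge (norm_pos_iff.2 hp) hp1 hx

end Order

/-- Hölder's inequality on the Fourier side, with `1/2 = 2/s + (s - 4)/(2s)`. -/
theorem enorm_fourierMul_toLp_le {E : Type*} [NormedAddCommGroup E] [InnerProductSpace ℝ E]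
    [FiniteDimensional ℝ E] [MeasurableSpace E] [BorelSpace E] {m : E → ℂ}
    (hm : MemLp m ∞ (volume : Measure E)) {s : ℝ} (hs : 4 < s) {u : E → ℂ} (h1 : MemLp u 1)
    (h2 : MemLp u 2) :
    ‖fourierMul hm (h2.toLp u)‖ₑ ≤ eLpNorm m (ENNReal.ofReal (s / 2)) volume *
      eLpNorm (𝓕 u) (ENNReal.ofReal (2 * (s / (s - 4)))) volume := by
  have hs4 : 0 < s - 4 := by linarith
  have hs0 : 0 < s := by linarith
  have : ENNReal.HolderTriple (ENNReal.ofReal (s / 2)) (ENNReal.ofReal (2 * (s / (s - 4)))) 2 := by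
    constructor
    rw [← ENNReal.ofReal_inv_of_pos (by positivity), ← ENNReal.ofReal_inv_of_pos (by positivity),
      ← ENNReal.ofReal_add (by positivity) (by positivity), ← ENNReal.ofReal_ofNat 2,
      ← ENNReal.ofReal_inv_of_pos (by positivity)]
    congr 1
    field_simp
    ring
  have hu := coeFn_fourier_toLp h1 h2
  rw [enorm_fourierMul, ← eLpNorm_congr_ae hu]
  have h := eLpNorm_smul_le_mul_eLpNorm (𝕜 := ℂ) (r := 2) (p := ENNReal.ofReal (s / 2))
    (q := ENNReal.ofReal (2 * (s / (s - 4)))) (Lp.memLp (𝓕 (h2.toLp u))).1 hm.1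
  exact h

/-! ### The resolvent estimates -/

/-- The resolvent estimate `‖(-Δ + z)⁻¹ z u‖ ≤ c |z| ^ (d/s) ‖û‖_{2s'}`, with the factor `|z|` taken
out of the operator. -/
theorem enorm_resolvent_le {d : ℕ} {s c : ℝ} (hs : 4 < s) {z : ℂ} (hz : 0 ≤ z.re) (hz0 : z ≠ 0)
    (hc : eLpNorm (resolventSymbol z) (ENNReal.ofReal (s / 2)) (volume : Measure (Space d)) ≤
      ENNReal.ofReal (c * ‖z‖ ^ (d / s - 1)))
    {u : Space d → ℂ} (h1 : MemLp u 1) (h2 : MemLp u 2) :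
    ENNReal.ofReal ‖z‖ * ‖fourierMul (memLp_top_resolventSymbol hz hz0) (h2.toLp u)‖ₑ ≤
      ENNReal.ofReal c * eLpNorm (𝓕 u) (ENNReal.ofReal (2 * (s / (s - 4)))) volume *
        ENNReal.ofReal (‖z‖ ^ (d / s)) := by
  have hzn : 0 < ‖z‖ := norm_pos_iff.2 hz0
  calc _ ≤ ENNReal.ofReal ‖z‖ * (ENNReal.ofReal (c * ‖z‖ ^ (d / s - 1)) *
        eLpNorm (𝓕 u) (ENNReal.ofReal (2 * (s / (s - 4)))) volume) := by
        gcongr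
        exact (enorm_fourierMul_toLp_le _ hs h1 h2).trans (by gcongr)
    _ = _ := by
        rw [ENNReal.ofReal_mul' (by positivity), Real.rpow_sub_one hzn.ne',
          show ENNReal.ofReal (‖z‖ ^ ((d : ℝ) / s)) =
            ENNReal.ofReal ‖z‖ * ENNReal.ofReal (‖z‖ ^ ((d : ℝ) / s) / ‖z‖) by
              rw [← ENNReal.ofReal_mul hzn.le]; congr 1; field_simp]
        ring

/-- The bound for the perturbed resolvent applied to `(z - W) u`, in terms of the unperturbed
one. -/
theorem enorm_perturbed_le {d : ℕ} {z : ℂ} {R S : L2 d →L[ℂ] L2 d} (hS : ∀ f, ‖S f‖ ≤ 2 * ‖R f‖)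
    {V W : Space d → ℂ} (hW : MemLp W ∞ volume) (hVW : ∀ᵐ x, V x = z - W x) {b : ℝ}
    (hb : ∀ f, ‖R (mulLp hW f)‖ ≤ b * ‖f‖) {u : Space d → ℂ} (hu : MemLp u 2 volume)
    (h : MemLp (fun x => V x * u x) 2 volume) :
    ‖S (h.toLp _)‖ₑ ≤ 2 * (ENNReal.ofReal ‖z‖ * ‖R (hu.toLp u)‖ₑ +
      ENNReal.ofReal b * eLpNorm u 2 volume) := by
  have hsplit : h.toLp _ = z • hu.toLp u - mulLp hW (hu.toLp u) := by
    apply Lp.ext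
    filter_upwards [h.coeFn_toLp, hu.coeFn_toLp, Lp.coeFn_smul z (hu.toLp u),
      Lp.coeFn_sub (z • hu.toLp u) (mulLp hW (hu.toLp u)), coeFn_mulLp hW (hu.toLp u), hVW]
      with x h1 h2 h3 h4 h5 h6
    rw [h1, h4, Pi.sub_apply, h3, Pi.smul_apply, h5, h2, h6, smul_eq_mul]
    ring
  have hnorm : ‖S (h.toLp _)‖ ≤ 2 * (‖z‖ * ‖R (hu.toLp u)‖ + b * ‖hu.toLp u‖) := by
    refine (hS _).trans ?_
    gcongr
    rw [hsplit, map_sub, map_smul]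
    refine (norm_sub_le _ _).trans ?_
    rw [norm_smul]
    gcongr
    exact hb _
  have hb0 : 0 ≤ b * ‖hu.toLp u‖ := (norm_nonneg _).trans (hb _)
  rw [← Lp.enorm_toLp hu, ← ofReal_norm, ← ofReal_norm (R _), ← ofReal_norm (hu.toLp u),
    ← ENNReal.ofReal_mul (norm_nonneg _), ← ENNReal.ofReal_mul' (norm_nonneg _),
    ← ENNReal.ofReal_add (by positivity) hb0]
  refine (ENNReal.ofReal_le_ofReal hnorm).trans (le_of_eq ?_)
  rw [ENNReal.ofReal_mul (by norm_num), ENNReal.ofReal_ofNat]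

theorem proposition3p1 (d : ℕ) (hd : 2 ≤ d) (s : ℝ) (hs : max (d : ℝ) 4 < s) :
    -- variable order: `C₀` depends on `d, s` only, `C` on `d, s, K` only
    (∃ C₀ : ℝ, 0 < C₀ ∧ ∀ K : Set (Space d), IsCompact K → ∃ C : ℝ, 0 < C ∧
      ∀ αm αs : ℝ, 0 < αm → αm ≤ αs → αs < 1 → αs * (1 - d / s) < αm →
        0 < smallRadius C₀ s K αm αs ∧
        ∀ (αM : ℝ) (κ : Space d → ℝ), αm < αM → αM < 1 → αs ≤ αM →
          AEMeasurable κ (volume.restrict K) →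
          (∀ᵐ x ∂(volume.restrict K), κ x ∈ Icc αm αM) →
          ∀ r β : ℝ, 0 < r → r < smallRadius C₀ s K αm αs →
            β ∈ Icc (-sectorAngle αs) (sectorAngle αs) →
            let α : Space d → ℝ := variableOrder K αs κ
            let p : ℂ := r * Complex.exp (β * Complex.I)
            -- `r₀` is a radius of smallness: `‖(p^αs - p^α) (-Δ + p^αs)⁻¹‖ ≤ 1/2`
            (∃ R : L2 d →L[ℂ] L2 d,
              IsInverseNegLaplacianAdd (powOrder p fun _ => αs) R ∧
              ∀ f : L2 d,
                eLpNorm (fun x => (p ^ (αs : ℂ) - powOrder p α x) * R f x) 2 volume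
                  ≤ 2⁻¹ * ‖f‖ₑ) ∧
            -- the estimate of `(-Δ + p^α)⁻¹ p^α u₀`
            ((¬ ∃ c : ℝ, ∀ᵐ x : Space d, α x = c) →
              ∃ R : L2 d →L[ℂ] L2 d, IsInverseNegLaplacianAdd (powOrder p α) R ∧
                ∀ u₀ : Space d → ℂ, MemLp u₀ 1 volume → MemLp u₀ 2 volume →
                  MemLp (𝓕 u₀) (ENNReal.ofReal (2 * (s / (s - 4)))) volume ∧
                  ∃ h : MemLp (fun x => powOrder p α x * u₀ x) 2 volume,
                    ‖R (h.toLp _)‖ₑ ≤ ENNReal.ofReal C *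
                      (eLpNorm u₀ 2 volume +
                        eLpNorm (𝓕 u₀) (ENNReal.ofReal (2 * (s / (s - 4)))) volume) *
                      ENNReal.ofReal (r ^ (αm - αs * (1 - d / s))))) ∧
    -- constant order: `C` depends on `d, s` only
    (∃ C : ℝ, 0 < C ∧ ∀ αs : ℝ, 0 < αs → αs < 1 →
      ∀ α : Space d → ℝ, (∀ᵐ x : Space d, α x = αs) →
        ∀ r β : ℝ, 0 < r → r < 1 → β ∈ Icc (-sectorAngle αs) (sectorAngle αs) →
          let p : ℂ := r * Complex.exp (β * Complex.I)
          ∃ R : L2 d →L[ℂ] L2 d, IsInverseNegLaplacianAdd (powOrder p α) R ∧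
            ∀ u₀ : Space d → ℂ, MemLp u₀ 1 volume → MemLp u₀ 2 volume →
              MemLp (𝓕 u₀) (ENNReal.ofReal (2 * (s / (s - 4)))) volume ∧
              ∃ h : MemLp (fun x => powOrder p α x * u₀ x) 2 volume,
                ‖R (h.toLp _)‖ₑ ≤ ENNReal.ofReal C *
                  eLpNorm (𝓕 u₀) (ENNReal.ofReal (2 * (s / (s - 4)))) volume *
                  ENNReal.ofReal (r ^ (αs * (d / s)))) := by
  have hd0 : (0 : ℝ) < d := by
    have : (2 : ℝ) ≤ d := by exact_mod_cast hd
    linarith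
  have hds : (d : ℝ) < s := (le_max_left _ _).trans_lt hs
  have hs4 : 4 < s := (le_max_right _ _).trans_lt hs
  have hs0 : 0 < s := by linarith
  have hq : 2 ≤ 2 * (s / (s - 4)) := by
    have : 1 ≤ s / (s - 4) := by rw [le_div_iff₀ (by linarith)]; linarith
    linarith
  obtain ⟨c, hc0, hc⟩ : ∃ c : ℝ, 0 < c ∧ ∀ z : ℂ, 0 ≤ z.re → z ≠ 0 →
      eLpNorm (resolventSymbol z) (ENNReal.ofReal (s / 2)) (volume : Measure (Space d)) ≤
        ENNReal.ofReal (c * ‖z‖ ^ (d / s - 1)) := by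
    have h := exists_eLpNorm_resolventSymbol_le (E := Space d) (σ := s / 2)
      (by rw [finrank_euclideanSpace_fin]; linarith)
    rwa [finrank_euclideanSpace_fin, mul_div_cancel₀ s two_ne_zero] at h
  refine ⟨⟨4 * c, by positivity, fun K hK => ?_⟩, ⟨c, hc0, ?_⟩⟩
  · have hKm : MeasurableSet K := hK.measurableSet
    have hKfin : volume K ≠ ∞ := hK.measure_lt_top.ne
    set a := (volume K).toReal with ha
    have ha0 : 0 ≤ a := ENNReal.toReal_nonneg
    refine ⟨2 * c + 2 * (4 * c * a ^ (2 / s)), by positivity, ?_⟩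
    intro αm αs hαm hms hαs1 hlt
    have hαs : 0 < αs := hαm.trans_le hms
    set γ := αm - αs * (1 - d / s) with hγ
    have hγ0 : 0 < γ := sub_pos.2 hlt
    refine ⟨smallRadius_pos hKfin hs0 hγ0, ?_⟩
    intro αM κ _ _ _ hκm hκ r β hr hrs hβ α p
    have hr1 : r < 1 := lt_one_of_lt_smallRadius hrs
    have hp0 : p ≠ 0 := polar_ne_zero hr β
    have hpn : ‖p‖ = r := by
      simp only [p]
      rw [norm_mul, Complex.norm_exp_ofReal_mul_I, mul_one, Complex.norm_real,
        Real.norm_of_nonneg hr.le]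
    set z : ℂ := p ^ (αs : ℂ) with hz
    have hzn : ‖z‖ = r ^ αs := norm_polar_cpow hr β αs
    have hzre : 0 ≤ z.re := re_polar_cpow_nonneg hr hαs hβ
    have hz0 : z ≠ 0 := norm_pos_iff.1 (by rw [hzn]; positivity)
    have hαmeas : AEMeasurable α := aemeasurable_variableOrder hKm αs hκm
    have hWK : ∀ᵐ x, ‖z - powOrder p α x‖ ≤ K.indicator (fun _ => 2 * r ^ αm) x :=
      norm_sub_powOrder_variableOrder_le hKm hms hκ hr hr1 β
    have hM : (0 : ℝ) ≤ 2 * r ^ αm := by positivity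
    have hW : MemLp (fun x => z - powOrder p α x) ∞ volume := by
      refine memLp_top_of_bound
        (aemeasurable_const.sub (aemeasurable_powOrder hp0 hαmeas)).aestronglyMeasurable
        (2 * r ^ αm) ?_
      filter_upwards [hWK] with x hx
      exact hx.trans (Set.indicator_le_self' (fun _ _ => hM) x)
    have hB : 0 < c * ‖z‖ ^ ((d : ℝ) / s - 1) := by rw [hzn]; positivity
    -- `b` is the common bound of `‖R W‖` and `‖W R‖`
    set b := 4 * c * a ^ (2 / s) * r ^ γ with hb
    have hb_half : b ≤ 2⁻¹ := mul_rpow_le_of_lt_smallRadius (by positivity) hγ0 hr hrs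
    have hb_eq : 2 * (2 * r ^ αm) * a ^ (1 / (s / 2)) * (c * ‖z‖ ^ ((d : ℝ) / s - 1)) = b := by
      have h1 : r ^ γ = r ^ αm * (r ^ αs) ^ ((d : ℝ) / s - 1) := by
        rw [← Real.rpow_mul hr.le, ← Real.rpow_add hr, hγ]
        ring_nf
      rw [hb, h1, hzn, one_div_div]
      ring
    set R := fourierMul (memLp_top_resolventSymbol (E := Space d) hzre hz0) with hR
    have hRinv : IsInverseNegLaplacianAdd (fun _ : Space d => z) R :=
      isInverseNegLaplacianAdd_const hzre hz0
    have hRW : ∀ f, ‖R (mulLp hW f)‖ ≤ b * ‖f‖ := fun f => by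
      rw [← hb_eq]
      exact norm_fourierMul_mulLp_le _ hW hKm hKfin hM hWK (by linarith) hB (hc z hzre hz0) f
    have hWR : ∀ f, ‖mulLp hW (R f)‖ ≤ b * ‖f‖ := fun f => by
      rw [← hb_eq]
      exact norm_mulLp_fourierMul_le _ hW hKm hKfin hM hWK (by linarith) hB (hc z hzre hz0) f
    refine ⟨⟨R, hRinv, fun f => ?_⟩, fun _ => ?_⟩
    · rw [← enorm_mulLp hW, ← ofReal_norm, ← ofReal_norm,
        show (2⁻¹ : ℝ≥0∞) = ENNReal.ofReal 2⁻¹ by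
          rw [ENNReal.ofReal_inv_of_pos (by norm_num), ENNReal.ofReal_ofNat],
        ← ENNReal.ofReal_mul (by norm_num)]
      exact ENNReal.ofReal_le_ofReal ((hWR f).trans (by gcongr))
    · have hVW : ∀ᵐ x, powOrder p α x = z - (z - powOrder p α x) :=
        Filter.Eventually.of_forall fun x => (sub_sub_cancel _ _).symm
      obtain ⟨S, hSinv, hSn⟩ := exists_isInverseNegLaplacianAdd_of_perturbation hRinv hW hVW
        fun f => (hRW f).trans (by gcongr)
      refine ⟨S, hSinv, fun u hu1 hu2 => ⟨memLp_fourier hu1 hu2 hq, ?_⟩⟩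
      have hαlow : ∀ᵐ x, αm ≤ α x := by
        filter_upwards [(ae_restrict_iff' hKm).1 hκ] with x hx
        by_cases hxK : x ∈ K
        · simpa [α, variableOrder, hxK] using (hx hxK).1
        · simpa [α, variableOrder, hxK] using hms
      have hmem := memLp_powOrder_mul hp0 hαmeas (by rw [hpn]; exact hr1.le) hαlow hu2
      refine ⟨hmem, (enorm_perturbed_le hSn hW hVW hRW hu2 hmem).trans ?_⟩
      set N := eLpNorm (𝓕 u) (ENNReal.ofReal (2 * (s / (s - 4)))) volume with hN
      have h1 : ENNReal.ofReal ‖z‖ * ‖R (hu2.toLp u)‖ₑ ≤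
          ENNReal.ofReal c * N * ENNReal.ofReal (r ^ γ) := by
        refine (enorm_resolvent_le hs4 hzre hz0 (hc z hzre hz0) hu1 hu2).trans ?_
        gcongr ENNReal.ofReal c * N * ENNReal.ofReal ?_
        rw [hzn, ← Real.rpow_mul hr.le]
        -- `γ ≤ αs d / s` because `αm ≤ αs`, and `r < 1`
        refine Real.rpow_le_rpow_of_exponent_ge hr hr1.le ?_
        rw [hγ]
        linarith
      calc 2 * (ENNReal.ofReal ‖z‖ * ‖R (hu2.toLp u)‖ₑ + ENNReal.ofReal b * eLpNorm u 2 volume)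
          ≤ 2 * (ENNReal.ofReal c * N * ENNReal.ofReal (r ^ γ) +
            ENNReal.ofReal (4 * c * a ^ (2 / s)) * ENNReal.ofReal (r ^ γ) *
              eLpNorm u 2 volume) := by
            rw [← ENNReal.ofReal_mul (by positivity), ← hb]
            gcongr
        _ = (ENNReal.ofReal (2 * c) * N + ENNReal.ofReal (2 * (4 * c * a ^ (2 / s))) *
              eLpNorm u 2 volume) * ENNReal.ofReal (r ^ γ) := by
            rw [ENNReal.ofReal_mul (p := 2) (by norm_num),
              ENNReal.ofReal_mul (p := 2) (by norm_num), ENNReal.ofReal_ofNat]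
            ring
        _ ≤ _ := by
            rw [mul_add, add_comm]
            gcongr
            · linarith [show 0 ≤ 2 * c by positivity]
            · linarith [show 0 ≤ 2 * (4 * c * a ^ (2 / s)) by positivity]
  · intro αs hαs hαs1 α hα r β hr hr1 hβ p
    have hp0 : p ≠ 0 := polar_ne_zero hr β
    have hpn : ‖p‖ = r := by
      simp only [p]
      rw [norm_mul, Complex.norm_exp_ofReal_mul_I, mul_one, Complex.norm_real,
        Real.norm_of_nonneg hr.le]
    set z : ℂ := p ^ (αs : ℂ) with hz
    have hzn : ‖z‖ = r ^ αs := norm_polar_cpow hr β αs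
    have hzre : 0 ≤ z.re := re_polar_cpow_nonneg hr hαs hβ
    have hz0 : z ≠ 0 := norm_pos_iff.1 (by rw [hzn]; positivity)
    have hV : (fun _ : Space d => z) =ᵐ[volume] powOrder p α := by
      filter_upwards [hα] with x hx
      rw [powOrder, hx]
    refine ⟨_, (isInverseNegLaplacianAdd_const hzre hz0).congr hV, fun u hu1 hu2 =>
      ⟨memLp_fourier hu1 hu2 hq, ?_⟩⟩
    have hmem : MemLp (fun x => powOrder p α x * u x) 2 volume := by
      refine (memLp_congr_ae ?_).1 (hu2.const_mul z)
      filter_upwards [hV] with x hx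
      rw [← hx]
    have he : hmem.toLp _ = z • hu2.toLp u := by
      apply Lp.ext
      filter_upwards [hmem.coeFn_toLp, hu2.coeFn_toLp, Lp.coeFn_smul z (hu2.toLp u), hV]
        with x h1 h2 h3 h4
      rw [h1, h3, Pi.smul_apply, h2, ← h4, smul_eq_mul]
    refine ⟨hmem, ?_⟩
    have h := enorm_resolvent_le hs4 hzre hz0 (hc z hzre hz0) hu1 hu2
    rw [he, map_smul, enorm_smul, ← ofReal_norm z]
    refine h.trans (le_of_eq ?_)
    rw [hzn, ← Real.rpow_mul hr.le]
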